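/- Let $\mathcal X,\mathcal Y$ be non-empty sets, let $\mathcal F$ be a $\sigma$-algebra on $\mathcal Y$, and let $f:\mathcal X\to[0,+\infty)$ and $g:\mathcal X\times\mathcal Y\to[0,+\infty)$ be functions such that $g(x,\cdot)$ is $\mathcal F$-measurable for every $x\in\mathcal X$. For $n\in\mathbb N=\{1,2,\dots\}$ and $\mathbf x=(x_1,\dots,x_n)\in\mathcal X^n$ write $f^{\otimes n}(\mathbf x)=\prod_{j=1}^n f(x_j)$ and $g_y^{\otimes n}(\mathbf x)=\prod_{j=1}^n g(x_j,y)$. We use $\log 0=-\infty$, $\log(+\infty)=+\infty$, $e^{-\infty}=0$; the integral of a measurable $[-\infty,+\infty]$-valued function is said to exist if the integral of its positive part or that of its negative part is finite, and it is then the difference of the two. Consider the following statements. (i) There is a probability measure $\nu$ on $\mathcal F$ such that, for every $x\in\mathcal X$, the integral $\int_{\mathcal Y}\log g(x,y)\,d\nu(y)$ exists in $[-\infty,+\infty)$ and $$f(x)\le\exp\left(\int_{\mathcal Y}\log g(x,y)\,d\nu(y)\right).$$ (ii) There is a sequence $(\nu_n)_{n\in\mathbb N}$ of probability measures on $\mathcal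 F$ such that, for every $n\in\mathbb N$ and every $\mathbf x\in\mathcal X^n$, the integral $\int_{\mathcal Y}\log g_y^{\otimes n}(\mathbf x)\,d\nu_n(y)$ exists in $[-\infty,+\infty)$ and $$f^{\otimes n}(\mathbf x)\le\exp\left(\int_{\mathcal Y}\log g_y^{\otimes n}(\mathbf x)\,d\nu_n(y)\right).$$ (iii) There is a probability measure $\mu$ on $\mathcal F$ such that, for every $n\in\mathbb N$ and every $\mathbf x\in\mathcal X^n$, $$f^{\otimes n}(\mathbf x)\le\int_{\mathcal Y}g_y^{\otimes n}(\mathbf x)\,d\mu(y).$$ (iv) There is a sequence $(\mu_n)_{n\in\mathbb N}$ of positive measures on $\mathcal F$ such that $$\limsup_{n\to+\infty}\frac1n\log\mu_n(\mathcal Y)\le 0$$ and, for every $n\in\mathbb N$ and every $\mathbf x\in\mathcal X^n$, $$f^{\otimes n}(\mathbf x)\le\int_{\mathcal Y}g_y^{\otimes n}(\mathbf x)\,d\mu_n(y).$$ (The integrals in (iii) and (iv) take values in $[0,+\infty]$.) Then (i)$\iff$(ii)$\implies$(iii)$\implies$(iv). Moreover, if $\mathcal Y$ is a compact Hausdorff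 topological space, $\mathcal F$ is its Borel $\sigma$-algebra, and $g(x,\cdot)$ is continuous on $\mathcal Y$ for every $x\in\mathcal X$, then also (iv)$\implies$(i). -/

import Mathlib

open MeasureTheory Filter Topology
open scoped NNReal ENNReal

namespace MeanBounds

/-- The integral of an extended-real-valued (measurable) function exists in `[-∞, +∞]`: at least
one of the integrals of its positive and negative parts is finite. -/
def IntegralExists {Y : Type*} [MeasurableSpace Y] (ν : Measure Y) (φ : Y → EReal) : Prop :=
  ∫⁻ y, (φ y).toENNReal ∂ν ≠ ⊤ ∨ ∫⁻ y, (-φ y).toENNReal ∂ν ≠ ⊤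

/-- The extended-real value of the integral, the integral of the positive part minus that of the
negative part. It is meaningful when `IntegralExists ν φ` holds. -/
noncomputable def extIntegral {Y : Type*} [MeasurableSpace Y] (ν : Measure Y) (φ : Y → EReal) :
    EReal :=
  ((∫⁻ y, (φ y).toENNReal ∂ν : ℝ≥0∞) : EReal) - ((∫⁻ y, (-φ y).toENNReal ∂ν : ℝ≥0∞) : EReal)

/-- The `n`-th tensor power of a function. -/
def tensorPow {X : Type*} (f : X → ℝ≥0) (n : ℕ) (x : Fin n → X) : ℝ≥0 :=
  ∏ j, f (x j)

/-- `log a` for `a ∈ [0, ∞)`, as an extended real number, with `log 0 = -∞`. -/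
noncomputable def elog (a : ℝ≥0) : EReal := ENNReal.log (a : ℝ≥0∞)

/-- Single-copy upper bound by a weighted geometric mean. -/
def SingleCopyGeometric {X Y : Type*} [MeasurableSpace Y] (f : X → ℝ≥0) (g : X → Y → ℝ≥0) : Prop :=
  ∃ ν : Measure Y, IsProbabilityMeasure ν ∧
    (∀ x : X, IntegralExists ν (fun y => elog (g x y)) ∧
      extIntegral ν (fun y => elog (g x y)) < ⊤) ∧
    ∀ x : X, (f x : ℝ≥0∞) ≤ EReal.exp (extIntegral ν (fun y => elog (g x y)))

/-- Multi-copy upper bounds by a sequence of weighted geometric means (indices `n ≥ 1`). -/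
def MultiCopyGeometric {X Y : Type*} [MeasurableSpace Y] (f : X → ℝ≥0) (g : X → Y → ℝ≥0) : Prop :=
  ∃ ν : ℕ → Measure Y, (∀ n, 1 ≤ n → IsProbabilityMeasure (ν n)) ∧
    (∀ n, 1 ≤ n → ∀ x : Fin n → X,
      IntegralExists (ν n) (fun y => elog (tensorPow (fun z => g z y) n x)) ∧
      extIntegral (ν n) (fun y => elog (tensorPow (fun z => g z y) n x)) < ⊤) ∧
    ∀ n, 1 ≤ n → ∀ x : Fin n → X, (tensorPow f n x : ℝ≥0∞) ≤
      EReal.exp (extIntegral (ν n) (fun y => elog (tensorPow (fun z => g z y) n x)))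

/-- Multi-copy upper bounds by a weighted arithmetic mean, with one measure for all `n ≥ 1`. -/
def MultiCopyArithmetic {X Y : Type*} [MeasurableSpace Y] (f : X → ℝ≥0) (g : X → Y → ℝ≥0) : Prop :=
  ∃ μ : Measure Y, IsProbabilityMeasure μ ∧
    ∀ n, 1 ≤ n → ∀ x : Fin n → X,
      (tensorPow f n x : ℝ≥0∞) ≤ ∫⁻ y, (tensorPow (fun z => g z y) n x : ℝ≥0∞) ∂μ

/-- Multi-copy upper bounds by a sequence of weighted arithmetic means (indices `n ≥ 1`), the
total masses of the positive measures growing at most subexponentially. -/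
def MultiCopyArithmeticSeq {X Y : Type*} [MeasurableSpace Y] (f : X → ℝ≥0) (g : X → Y → ℝ≥0) :
    Prop :=
  ∃ μ : ℕ → Measure Y,
    limsup (fun n : ℕ => ENNReal.log (μ n Set.univ) / (n : EReal)) atTop ≤ 0 ∧
    ∀ n, 1 ≤ n → ∀ x : Fin n → X,
      (tensorPow f n x : ℝ≥0∞) ≤ ∫⁻ y, (tensorPow (fun z => g z y) n x : ℝ≥0∞) ∂(μ n)

end MeanBounds

/-!
The integral of `log g` is additive over products, so a geometric bound for one copy is one for
every number of copies, and Jensen's inequality turns geometric bounds into arithmetic ones.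

For the converse on a compact space, consider the continuous functions `h` majorizing some
`y ↦ ∑ log (g xⱼ y) - ∑ log (f xⱼ)`. If such an `h` were everywhere negative, then on `k` copies of
`(xⱼ)` the right-hand side of (iv) would be exponentially small relative to the left-hand side, up
to the subexponential mass of the measure; so every such `h` is nonnegative somewhere. These `h`
form an additive monoid. Approximating real coefficients by rationals and clearing denominators, the
convex cone it generates together with the nonnegative functions still omits the constant `-1`. The
M. Riesz extension theorem then gives a positive functional that is nonnegative on the monoid, and
Riesz–Markov represents it by a probability measure `ν`. Testing `ν` on truncations of
`log (g x ·) - log (f x)` and letting the truncation level tend to `-∞` yields (i).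
-/

namespace MeanBounds

section ExtIntegral

/-- `(a + b)⁺ - (a + b)⁻ = (a⁺ - a⁻) + (b⁺ - b⁻)`, rearranged to avoid the truncated subtraction
of `ℝ≥0∞`. -/
theorem toENNReal_add_add_neg_parts (a b : EReal) :
    (a + b).toENNReal + ((-a).toENNReal + (-b).toENNReal) =
      (-(a + b)).toENNReal + (a.toENNReal + b.toENNReal) := by
  induction a with
  | bot => simp
  | top => induction b <;> simp
  | coe x =>
    induction b with
    | bot => simp
    | top => simp
    | coe y =>
      simp only [← EReal.coe_add, ← EReal.coe_neg, EReal.real_coe_toENNReal, ENNReal.ofReal,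
        ← ENNReal.coe_add]
      congr 1
      ext
      simp only [NNReal.coe_add, Real.coe_toNNReal']
      grind

theorem toReal_toENNReal_sub_toReal_toENNReal_neg (a : EReal) :
    a.toENNReal.toReal - (-a).toENNReal.toReal = a.toReal := by
  induction a with
  | bot => simp
  | top => simp
  | coe x =>
    rw [← EReal.coe_neg, EReal.real_coe_toENNReal, EReal.real_coe_toENNReal,
      ENNReal.toReal_ofReal', ENNReal.toReal_ofReal', EReal.toReal_coe]
    exact max_zero_sub_max_neg_zero_eq_self x

variable {Y : Type*} [MeasurableSpace Y] {ν : Measure Y} {φ ψ : Y → EReal}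

theorem integralExists_and_extIntegral_lt_top_iff :
    (IntegralExists ν φ ∧ extIntegral ν φ < ⊤) ↔ ∫⁻ y, (φ y).toENNReal ∂ν ≠ ⊤ := by
  unfold IntegralExists extIntegral
  generalize ∫⁻ y, (φ y).toENNReal ∂ν = a
  generalize ∫⁻ y, (-φ y).toENNReal ∂ν = b
  induction a <;> induction b <;> simp [EReal.sub_lt_iff]

theorem extIntegral_eq_bot (hφ : ∫⁻ y, (-φ y).toENNReal ∂ν = ⊤) : extIntegral ν φ = ⊥ := by
  simp [extIntegral, hφ]

theorem extIntegral_of_ne_top (hpos : ∫⁻ y, (φ y).toENNReal ∂ν ≠ ⊤)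
    (hneg : ∫⁻ y, (-φ y).toENNReal ∂ν ≠ ⊤) :
    extIntegral ν φ =
      ((∫⁻ y, (φ y).toENNReal ∂ν).toReal - (∫⁻ y, (-φ y).toENNReal ∂ν).toReal : ℝ) := by
  rw [extIntegral, EReal.coe_sub, EReal.coe_ennreal_toReal hpos, EReal.coe_ennreal_toReal hneg]

theorem extIntegral_coe {u : Y → ℝ} (hu : Integrable u ν) :
    extIntegral ν (fun y => (u y : EReal)) = (∫ y, u y ∂ν : ℝ) := by
  rw [extIntegral_of_ne_top hu.lintegral_lt_top.ne hu.neg.lintegral_lt_top.ne,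
    integral_eq_lintegral_pos_part_sub_lintegral_neg_part hu]
  rfl

theorem extIntegral_congr_ae (h : φ =ᵐ[ν] ψ) : extIntegral ν φ = extIntegral ν ψ := by
  unfold extIntegral
  congr 2 <;> refine lintegral_congr_ae ?_ <;> filter_upwards [h] with y hy <;> rw [hy]

theorem lintegral_toENNReal_add_ne_top (hφ : Measurable φ)
    (hφpos : ∫⁻ y, (φ y).toENNReal ∂ν ≠ ⊤) (hψpos : ∫⁻ y, (ψ y).toENNReal ∂ν ≠ ⊤) :
    ∫⁻ y, (φ y + ψ y).toENNReal ∂ν ≠ ⊤ := by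
  refine ne_top_of_le_ne_top ?_ (lintegral_mono fun y => EReal.toENNReal_add_le)
  rw [lintegral_add_left hφ.ereal_toENNReal]
  exact ENNReal.add_ne_top.2 ⟨hφpos, hψpos⟩

theorem lintegral_add_parts (hφ : Measurable φ) (hψ : Measurable ψ) :
    ∫⁻ y, (φ y + ψ y).toENNReal ∂ν +
        (∫⁻ y, (-φ y).toENNReal ∂ν + ∫⁻ y, (-ψ y).toENNReal ∂ν) =
      ∫⁻ y, (-(φ y + ψ y)).toENNReal ∂ν +
        (∫⁻ y, (φ y).toENNReal ∂ν + ∫⁻ y, (ψ y).toENNReal ∂ν) := by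
  have hφneg : Measurable fun y => (-φ y).toENNReal := hφ.neg.ereal_toENNReal
  have hsum : Measurable fun y => (φ y + ψ y).toENNReal := (hφ.add hψ).ereal_toENNReal
  have hsumneg : Measurable fun y => (-(φ y + ψ y)).toENNReal := (hφ.add hψ).neg.ereal_toENNReal
  rw [← lintegral_add_left hφneg, ← lintegral_add_left hφ.ereal_toENNReal,
    ← lintegral_add_left hsum, ← lintegral_add_left hsumneg]
  exact lintegral_congr fun y => toENNReal_add_add_neg_parts _ _

theorem extIntegral_add (hφ : Measurable φ) (hψ : Measurable ψ)
    (hφpos : ∫⁻ y, (φ y).toENNReal ∂ν ≠ ⊤) (hψpos : ∫⁻ y, (ψ y).toENNReal ∂ν ≠ ⊤) :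
    extIntegral ν (fun y => φ y + ψ y) = extIntegral ν φ + extIntegral ν ψ := by
  have parts := lintegral_add_parts (ν := ν) hφ hψ
  have hpos := lintegral_toENNReal_add_ne_top hφ hφpos hψpos
  by_cases hφneg : ∫⁻ y, (-φ y).toENNReal ∂ν = ⊤
  · have hneg : ∫⁻ y, (-(φ y + ψ y)).toENNReal ∂ν = ⊤ := by
      simpa [hφneg, hφpos, hψpos] using parts.symm
    rw [extIntegral_eq_bot hφneg, extIntegral_eq_bot hneg, EReal.bot_add]
  by_cases hψneg : ∫⁻ y, (-ψ y).toENNReal ∂ν = ⊤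
  · have hneg : ∫⁻ y, (-(φ y + ψ y)).toENNReal ∂ν = ⊤ := by
      simpa [hψneg, hφpos, hψpos] using parts.symm
    rw [extIntegral_eq_bot hψneg, extIntegral_eq_bot hneg, EReal.add_bot]
  have hneg : ∫⁻ y, (-(φ y + ψ y)).toENNReal ∂ν ≠ ⊤ := fun h => by
    simp [h, hpos, hφneg, hψneg] at parts
  rw [extIntegral_of_ne_top hpos hneg, extIntegral_of_ne_top hφpos hφneg,
    extIntegral_of_ne_top hψpos hψneg, ← EReal.coe_add, EReal.coe_eq_coe_iff]
  have hreal := congrArg ENNReal.toReal parts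
  rw [ENNReal.toReal_add hpos (ENNReal.add_ne_top.2 ⟨hφneg, hψneg⟩),
    ENNReal.toReal_add hneg (ENNReal.add_ne_top.2 ⟨hφpos, hψpos⟩),
    ENNReal.toReal_add hφneg hψneg, ENNReal.toReal_add hφpos hψpos] at hreal
  linarith

theorem lintegral_toENNReal_sum_ne_top {ι : Type*} {s : Finset ι} {φ : ι → Y → EReal}
    (hφ : ∀ i, Measurable (φ i)) (hpos : ∀ i, ∫⁻ y, (φ i y).toENNReal ∂ν ≠ ⊤) :
    ∫⁻ y, (∑ i ∈ s, φ i y).toENNReal ∂ν ≠ ⊤ := by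
  classical
  induction s using Finset.induction_on with
  | empty => simp
  | insert i s hi ih =>
    simp only [Finset.sum_insert hi]
    exact lintegral_toENNReal_add_ne_top (hφ i) (hpos i) ih

theorem extIntegral_sum {ι : Type*} {s : Finset ι} {φ : ι → Y → EReal}
    (hφ : ∀ i, Measurable (φ i)) (hpos : ∀ i, ∫⁻ y, (φ i y).toENNReal ∂ν ≠ ⊤) :
    extIntegral ν (fun y => ∑ i ∈ s, φ i y) = ∑ i ∈ s, extIntegral ν (φ i) := by
  classical
  induction s using Finset.induction_on with
  | empty => simp [extIntegral]
  | insert i s hi ih =>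
    simp only [Finset.sum_insert hi]
    rw [extIntegral_add (hφ i) (Finset.measurable_sum s fun j _ => hφ j) (hpos i)
      (lintegral_toENNReal_sum_ne_top hφ hpos), ih]

theorem ae_coe_toReal_eq (hφ : Measurable φ) (hpos : ∫⁻ y, (φ y).toENNReal ∂ν ≠ ⊤)
    (hneg : ∫⁻ y, (-φ y).toENNReal ∂ν ≠ ⊤) : ∀ᵐ y ∂ν, ((φ y).toReal : EReal) = φ y := by
  filter_upwards [ae_lt_top hφ.ereal_toENNReal hpos, ae_lt_top hφ.neg.ereal_toENNReal hneg]
    with y hy hy'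
  refine EReal.coe_toReal (EReal.toENNReal_ne_top_iff.1 hy.ne) fun hbot => ?_
  simp [hbot] at hy'

theorem integrable_toReal (hφ : Measurable φ) (hpos : ∫⁻ y, (φ y).toENNReal ∂ν ≠ ⊤)
    (hneg : ∫⁻ y, (-φ y).toENNReal ∂ν ≠ ⊤) : Integrable (fun y => (φ y).toReal) ν := by
  simp only [← toReal_toENNReal_sub_toReal_toENNReal_neg]
  exact (integrable_toReal_of_lintegral_ne_top hφ.ereal_toENNReal.aemeasurable hpos).sub
    (integrable_toReal_of_lintegral_ne_top hφ.neg.ereal_toENNReal.aemeasurable hneg)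

theorem exp_extIntegral_le_lintegral_exp [IsProbabilityMeasure ν] (hφ : Measurable φ)
    (hpos : ∫⁻ y, (φ y).toENNReal ∂ν ≠ ⊤) :
    EReal.exp (extIntegral ν φ) ≤ ∫⁻ y, EReal.exp (φ y) ∂ν := by
  by_cases hneg : ∫⁻ y, (-φ y).toENNReal ∂ν = ⊤
  · simp [extIntegral_eq_bot hneg]
  set u : Y → ℝ := fun y => (φ y).toReal
  have hu : Integrable u ν := integrable_toReal hφ hpos hneg
  have hφu : φ =ᵐ[ν] fun y => (u y : EReal) :=
    (ae_coe_toReal_eq hφ hpos hneg).mono fun _ => Eq.symm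
  have hexp : ∫⁻ y, EReal.exp (φ y) ∂ν = ∫⁻ y, ENNReal.ofReal (Real.exp (u y)) ∂ν := by
    refine lintegral_congr_ae ?_
    filter_upwards [hφu] with y hy
    rw [hy, EReal.exp_coe]
  rw [extIntegral_congr_ae hφu, extIntegral_coe hu, EReal.exp_coe, hexp]
  by_cases hfin : ∫⁻ y, ENNReal.ofReal (Real.exp (u y)) ∂ν = ⊤
  · simp [hfin]
  have hexpu : Integrable (fun y => Real.exp (u y)) ν :=
    (lintegral_ofReal_ne_top_iff_integrable
      (Real.measurable_exp.comp_aemeasurable hu.aemeasurable).aestronglyMeasurable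
      (Eventually.of_forall fun _ => (Real.exp_pos _).le)).1 hfin
  rw [← ofReal_integral_eq_lintegral_ofReal hexpu
    (Eventually.of_forall fun _ => (Real.exp_pos _).le)]
  exact ENNReal.ofReal_le_ofReal (convexOn_exp.map_integral_le Real.continuous_exp.continuousOn
    isClosed_univ (Eventually.of_forall fun _ => Set.mem_univ _) hu hexpu)

theorem tendsto_extIntegral_max_neg_natCast (hφ : Measurable φ)
    (hpos : ∫⁻ y, (φ y).toENNReal ∂ν ≠ ⊤) :
    Tendsto (fun k : ℕ => extIntegral ν (fun y => max (φ y) (-(k : EReal)))) atTop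
      (𝓝 (extIntegral ν φ)) := by
  have hposmax : ∀ (k : ℕ) (a : EReal), (max a (-(k : EReal))).toENNReal = a.toENNReal := by
    intro k a
    rcases le_total a (-(k : EReal)) with h | h
    · have hk : -(k : EReal) ≤ 0 := by simp
      rw [max_eq_right h, EReal.toENNReal_of_nonpos hk, EReal.toENNReal_of_nonpos (h.trans hk)]
    · rw [max_eq_left h]
  have hnegmax : ∀ (k : ℕ) (a : EReal),
      (-max a (-(k : EReal))).toENNReal = min (-a).toENNReal k := by
    intro k a
    have hmono : Monotone EReal.toENNReal := fun _ _ => EReal.toENNReal_le_toENNReal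
    rw [← EReal.min_neg_neg, neg_neg, hmono.map_min]
    rw [← EReal.coe_coe_eq_natCast, EReal.real_coe_toENNReal, ENNReal.ofReal_natCast]
  have hneg : Tendsto (fun k : ℕ => ∫⁻ y, min (-φ y).toENNReal k ∂ν) atTop
      (𝓝 (∫⁻ y, (-φ y).toENNReal ∂ν)) := by
    refine lintegral_tendsto_of_tendsto_of_monotone
      (fun k => (hφ.neg.ereal_toENNReal.min measurable_const).aemeasurable)
      (Eventually.of_forall fun y j k hjk => min_le_min_left _ (Nat.cast_le.2 hjk))
      (Eventually.of_forall fun y => ?_)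
    simpa using tendsto_const_nhds.min ENNReal.tendsto_nat_nhds_top
  simp only [extIntegral, hposmax, hnegmax, sub_eq_add_neg]
  have hcont := EReal.continuousAt_add
    (p := (((∫⁻ y, (φ y).toENNReal ∂ν : ℝ≥0∞) : EReal),
      -((∫⁻ y, (-φ y).toENNReal ∂ν : ℝ≥0∞) : EReal)))
    (Or.inl (EReal.coe_ennreal_eq_top_iff.not.2 hpos)) (Or.inl (EReal.coe_ennreal_ne_bot _))
  exact hcont.tendsto.comp (tendsto_const_nhds.prodMk_nhds
    (((continuous_coe_ennreal_ereal.tendsto _).comp hneg).neg))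

end ExtIntegral

section Elog

theorem measurable_elog : Measurable elog :=
  ENNReal.measurable_log.comp measurable_coe_nnreal_ennreal

theorem exp_elog (a : ℝ≥0) : EReal.exp (elog a) = a :=
  ENNReal.exp_log a

theorem elog_prod {ι : Type*} (s : Finset ι) (a : ι → ℝ≥0) :
    elog (∏ i ∈ s, a i) = ∑ i ∈ s, elog (a i) := by
  classical
  induction s using Finset.induction_on with
  | empty => simp [elog]
  | insert i s hi ih =>
    rw [Finset.prod_insert hi, Finset.sum_insert hi, ← ih]
    simp only [elog, ENNReal.coe_mul, ENNReal.log_mul_add]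

theorem exp_sum {ι : Type*} (s : Finset ι) (a : ι → EReal) :
    EReal.exp (∑ i ∈ s, a i) = ∏ i ∈ s, EReal.exp (a i) := by
  classical
  induction s using Finset.induction_on with
  | empty => simp
  | insert i s hi ih => rw [Finset.sum_insert hi, Finset.prod_insert hi, EReal.exp_add, ih]

end Elog

section Copies

variable {X Y : Type*} [MeasurableSpace Y] {f : X → ℝ≥0} {g : X → Y → ℝ≥0}

theorem measurable_tensorPow (hg : ∀ x, Measurable (g x)) {n : ℕ} (x : Fin n → X) :
    Measurable fun y => tensorPow (fun z => g z y) n x :=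
  Finset.measurable_prod _ fun j _ => hg (x j)

theorem exists_measure_tensorPow_le_exp_extIntegral (hg : ∀ x, Measurable (g x))
    (h : SingleCopyGeometric f g) :
    ∃ ν : Measure Y, IsProbabilityMeasure ν ∧ ∀ n (x : Fin n → X),
      ∫⁻ y, (elog (tensorPow (fun z => g z y) n x)).toENNReal ∂ν ≠ ⊤ ∧
      (tensorPow f n x : ℝ≥0∞) ≤
        EReal.exp (extIntegral ν fun y => elog (tensorPow (fun z => g z y) n x)) := by
  obtain ⟨ν, hν, hexists, hle⟩ := h
  refine ⟨ν, hν, fun n x => ?_⟩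
  have hmeas (j : Fin n) : Measurable fun y => elog (g (x j) y) := measurable_elog.comp (hg (x j))
  have hpos (j : Fin n) : ∫⁻ y, (elog (g (x j) y)).toENNReal ∂ν ≠ ⊤ :=
    integralExists_and_extIntegral_lt_top_iff.1 (hexists (x j))
  simp only [tensorPow, elog_prod]
  refine ⟨lintegral_toENNReal_sum_ne_top hmeas hpos, ?_⟩
  rw [extIntegral_sum hmeas hpos, exp_sum, ENNReal.ofNNReal_finsetProd]
  exact Finset.prod_le_prod' fun j _ => hle (x j)

theorem SingleCopyGeometric.multiCopyGeometric (hg : ∀ x, Measurable (g x))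
    (h : SingleCopyGeometric f g) : MultiCopyGeometric f g := by
  obtain ⟨ν, hν, hle⟩ := exists_measure_tensorPow_le_exp_extIntegral hg h
  exact ⟨fun _ => ν, fun _ _ => hν,
    fun n _ x => integralExists_and_extIntegral_lt_top_iff.2 (hle n x).1,
    fun n _ x => (hle n x).2⟩

theorem MultiCopyGeometric.singleCopyGeometric (h : MultiCopyGeometric f g) :
    SingleCopyGeometric f g := by
  obtain ⟨ν, hν, hexists, hle⟩ := h
  exact ⟨ν 1, hν 1 le_rfl, fun x => by simpa [tensorPow] using hexists 1 le_rfl fun _ => x,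
    fun x => by simpa [tensorPow] using hle 1 le_rfl fun _ => x⟩

theorem SingleCopyGeometric.multiCopyArithmetic (hg : ∀ x, Measurable (g x))
    (h : SingleCopyGeometric f g) : MultiCopyArithmetic f g := by
  obtain ⟨ν, hν, hle⟩ := exists_measure_tensorPow_le_exp_extIntegral hg h
  refine ⟨ν, hν, fun n _ x => (hle n x).2.trans ?_⟩
  simpa only [Function.comp_def, exp_elog] using exp_extIntegral_le_lintegral_exp
    (measurable_elog.comp (measurable_tensorPow hg x)) (hle n x).1

theorem MultiCopyArithmetic.multiCopyArithmeticSeq (h : MultiCopyArithmetic f g) :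
    MultiCopyArithmeticSeq f g := by
  obtain ⟨μ, hμ, hle⟩ := h
  exact ⟨fun _ => μ, by simp, hle⟩

end Copies

section ConvexCones

theorem exists_linearMap_eq_one_nonneg {E : Type*} [AddCommGroup E] [Module ℝ E]
    {C : PointedCone ℝ E} {e : E} (hdense : ∀ y, ∃ r : ℝ, r • e + y ∈ C) (he : -e ∉ C) :
    ∃ L : E →ₗ[ℝ] ℝ, L e = 1 ∧ ∀ x ∈ C, 0 ≤ L x := by
  have he₀ : e ≠ 0 := by
    rintro rfl
    simp at he
  let ℓ : E →ₗ.[ℝ] ℝ := LinearPMap.mkSpanSingleton e 1 he₀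
  have ℓ_smul (r : ℝ) (h : r • e ∈ ℓ.domain) : ℓ ⟨r • e, h⟩ = r :=
    (LinearPMap.mkSpanSingleton'_apply ..).trans (mul_one r)
  have smul_mem_domain (r : ℝ) : r • e ∈ ℓ.domain := Submodule.mem_span_singleton.2 ⟨r, rfl⟩
  have hnonneg (x : ℓ.domain) (hx : (x : E) ∈ C) : 0 ≤ ℓ x := by
    obtain ⟨x, hdom⟩ := x
    obtain ⟨r, rfl⟩ := Submodule.mem_span_singleton.1 hdom
    rw [ℓ_smul]
    by_contra! hr
    have hmem : (-r)⁻¹ • r • e ∈ C := C.smul_mem (inv_nonneg.2 (neg_nonneg.2 hr.le)) hx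
    rw [smul_smul, inv_neg, neg_mul, inv_mul_cancel₀ hr.ne, neg_one_smul] at hmem
    exact he hmem
  obtain ⟨L, hL, hLC⟩ := riesz_extension C ℓ hnonneg fun y =>
    (hdense y).imp' (fun r => ⟨r • e, smul_mem_domain r⟩) fun _ hr => hr
  refine ⟨L, ?_, hLC⟩
  simpa only [one_smul] using (hL ⟨_, smul_mem_domain 1⟩).trans (ℓ_smul 1 _)

theorem mem_closure_setOf_nsmul_mem {E : Type*} [AddCommGroup E] [Module ℝ E] [TopologicalSpace E]
    [ContinuousAdd E] [ContinuousSMul ℝ E] {P : AddSubmonoid E} {x : E}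
    (hx : x ∈ PointedCone.hull ℝ (P : Set E)) :
    x ∈ closure {x : E | ∃ N : ℕ, N ≠ 0 ∧ N • x ∈ P} := by
  set S : Set E := {x : E | ∃ N : ℕ, N ≠ 0 ∧ N • x ∈ P}
  have add_mem_S : ∀ a ∈ S, ∀ b ∈ S, a + b ∈ S := by
    rintro a ⟨M, hM, ha⟩ b ⟨N, hN, hb⟩
    refine ⟨M * N, mul_ne_zero hM hN, ?_⟩
    rw [smul_add, mul_comm, mul_smul, mul_comm, mul_smul]
    exact P.add_mem (P.nsmul_mem ha N) (P.nsmul_mem hb M)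
  have smul_mem_S (m n : ℕ) (a : E) (ha : a ∈ S) : ((m : ℝ) / (n + 1 : ℕ)) • a ∈ S := by
    obtain ⟨N, hN, ha⟩ := ha
    refine ⟨(n + 1) * N, by positivity, ?_⟩
    have : ((n + 1) * N) • ((m : ℝ) / (n + 1 : ℕ)) • a = m • N • a := by
      simp only [← Nat.cast_smul_eq_nsmul ℝ, smul_smul]
      congr 1
      push_cast
      field_simp
    rw [this]
    exact P.nsmul_mem ha m
  induction hx using Submodule.span_induction with
  | mem x hx => exact subset_closure ⟨1, one_ne_zero, by simpa using hx⟩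
  | zero => exact subset_closure ⟨1, one_ne_zero, by simp⟩
  | add x y _ _ ihx ihy => exact map_mem_closure₂ continuous_add ihx ihy add_mem_S
  | smul c x _ ih =>
    refine closure_closure (s := S) ▸ map_mem_closure (continuous_const_smul c) ih fun a ha => ?_
    have hlim : Tendsto (fun n : ℕ => ((⌊(c : ℝ) * (n + 1 : ℕ)⌋₊ : ℝ) / (n + 1 : ℕ)) • a) atTop
        (𝓝 ((c : ℝ) • a)) :=
      (((tendsto_nat_floor_mul_div_atTop c.2).comp tendsto_natCast_atTop_atTop).comp
        (tendsto_add_atTop_nat 1)).smul_const a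
    exact mem_closure_of_tendsto hlim (Eventually.of_forall fun n => smul_mem_S _ n a ha)

end ConvexCones

section RieszMarkov

variable {Y : Type*} [TopologicalSpace Y] [CompactSpace Y]

theorem exists_isProbabilityMeasure_integral_eq [T2Space Y] [MeasurableSpace Y] [BorelSpace Y]
    (L : C(Y, ℝ) →ₗ[ℝ] ℝ) (hL : ∀ h, 0 ≤ h → 0 ≤ L h) (hL1 : L 1 = 1) :
    ∃ ν : Measure Y, IsProbabilityMeasure ν ∧ ∀ h : C(Y, ℝ), ∫ y, h y ∂ν = L h := by
  let Λ : CompactlySupportedContinuousMap Y ℝ →ₚ[ℝ] ℝ := PositiveLinearMap.mk₀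
    { toFun := fun h => L h.toContinuousMap
      map_add' := fun a b => L.map_add a.toContinuousMap b.toContinuousMap
      map_smul' := fun c a => L.map_smul c a.toContinuousMap } (fun h hh => hL _ hh)
  have hint : ∀ h : C(Y, ℝ), ∫ y, h y ∂(RealRMK.rieszMeasure Λ) = L h := fun h =>
    RealRMK.integral_rieszMeasure Λ (CompactlySupportedContinuousMap.continuousMapEquiv h)
  refine ⟨RealRMK.rieszMeasure Λ, ⟨?_⟩, hint⟩
  have hone := hint 1
  simp only [ContinuousMap.one_apply, integral_const, smul_eq_mul, mul_one, hL1] at hone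
  exact (ENNReal.toReal_eq_one_iff _).1 hone

theorem neg_one_notMem_hull {P : AddSubmonoid C(Y, ℝ)} (hP : ∀ h ∈ P, ∃ y, 0 ≤ h y) :
    -1 ∉ PointedCone.hull ℝ ((P ⊔ AddSubmonoid.nonneg C(Y, ℝ) : AddSubmonoid _) : Set C(Y, ℝ)) := by
  intro hmem
  obtain ⟨q, ⟨N, hN, hNq⟩, hdist⟩ :=
    Metric.mem_closure_iff.1 (mem_closure_setOf_nsmul_mem hmem) 1 one_pos
  obtain ⟨h, hhP, p, hp, hsum⟩ := AddSubmonoid.mem_sup.1 hNq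
  obtain ⟨y, hy⟩ := hP h hhP
  have hqy : q y < 0 := by
    have := (ContinuousMap.dist_apply_le_dist y).trans_lt hdist
    rw [Real.dist_eq, abs_lt] at this
    simp only [ContinuousMap.neg_apply, ContinuousMap.one_apply] at this
    linarith
  have hpy : 0 ≤ p y := hp y
  have hsumy : h y + p y = N * q y := by simpa using DFunLike.congr_fun hsum y
  have : (N : ℝ) * q y < 0 := mul_neg_of_pos_of_neg (by positivity) hqy
  linarith

theorem exists_isProbabilityMeasure_integral_nonneg [T2Space Y] [MeasurableSpace Y] [BorelSpace Y]
    {P : AddSubmonoid C(Y, ℝ)} (hP : ∀ h ∈ P, ∃ y, 0 ≤ h y) :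
    ∃ ν : Measure Y, IsProbabilityMeasure ν ∧ ∀ h ∈ P, 0 ≤ ∫ y, h y ∂ν := by
  set C := PointedCone.hull ℝ
    ((P ⊔ AddSubmonoid.nonneg C(Y, ℝ) : AddSubmonoid C(Y, ℝ)) : Set C(Y, ℝ))
  have hnonneg (h : C(Y, ℝ)) (hh : 0 ≤ h) : h ∈ C :=
    PointedCone.subset_hull ((le_sup_right : _ ≤ P ⊔ AddSubmonoid.nonneg C(Y, ℝ)) hh)
  have hdense (h : C(Y, ℝ)) : ∃ r : ℝ, r • (1 : C(Y, ℝ)) + h ∈ C := by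
    refine ⟨‖h‖, hnonneg _ fun y => ?_⟩
    have := neg_le_of_abs_le (h.norm_coe_le_norm y)
    change 0 ≤ ‖h‖ * 1 + h y
    linarith
  obtain ⟨L, hL1, hLC⟩ := exists_linearMap_eq_one_nonneg hdense (neg_one_notMem_hull hP)
  obtain ⟨ν, hν, hint⟩ :=
    exists_isProbabilityMeasure_integral_eq L (fun h hh => hLC h (hnonneg h hh)) hL1
  refine ⟨ν, hν, fun h hh => ?_⟩
  rw [hint]
  exact hLC h (PointedCone.subset_hull ((le_sup_left : P ≤ _) hh))

end RieszMarkov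

section Growth

theorem le_of_pow_le_mul_of_expGrowthSup_nonpos {u : ℕ → ℝ≥0∞} (hu : ExpGrowth.expGrowthSup u ≤ 0)
    {n : ℕ} (hn : n ≠ 0) {b c : ℝ≥0}
    (hle : ∀ k : ℕ, k ≠ 0 → (c : ℝ≥0∞) ^ k ≤ (b : ℝ≥0∞) ^ k * u (k * n)) : c ≤ b := by
  have hbound (ε : ℝ) (hε : 0 < ε) : (c : ℝ≥0∞) ≤ b * ENNReal.ofReal (Real.exp (ε * n)) := by
    have hev : ∀ᶠ m in atTop, u m ≤ EReal.exp ((ε : EReal) * m) :=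
      ExpGrowth.expGrowthSup_le_iff.1 hu ε (by exact_mod_cast hε)
    have htend : Tendsto (fun k : ℕ => k * n) atTop atTop :=
      tendsto_id.atTop_mul_const' (Nat.pos_of_ne_zero hn)
    obtain ⟨k, hk, hk₀⟩ := ((htend.eventually hev).and (eventually_ne_atTop 0)).exists
    have hexp : EReal.exp ((ε : EReal) * (k * n : ℕ)) =
        ENNReal.ofReal (Real.exp (ε * n)) ^ k := by
      rw [← EReal.coe_coe_eq_natCast, ← EReal.coe_mul, EReal.exp_coe,
        ← ENNReal.ofReal_pow (Real.exp_pos _).le, ← Real.exp_nat_mul]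
      push_cast
      ring_nf
    refine (ENNReal.pow_le_pow_left_iff hk₀).1 ((hle k hk₀).trans ?_)
    rw [mul_pow, ← hexp]
    gcongr
  have hlim : Tendsto (fun ε : ℝ => (b : ℝ≥0∞) * ENNReal.ofReal (Real.exp (ε * n))) (𝓝[>] 0)
      (𝓝 b) := by
    have hcont : Continuous fun ε : ℝ => (b : ℝ≥0∞) * ENNReal.ofReal (Real.exp (ε * n)) :=
      (ENNReal.continuous_const_mul ENNReal.coe_ne_top).comp
        (ENNReal.continuous_ofReal.comp (by fun_prop))
    simpa using hcont.tendsto' 0 b (by simp) |>.mono_left nhdsWithin_le_nhds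
  exact ENNReal.coe_le_coe.1 (ge_of_tendsto hlim (eventually_mem_nhdsWithin.mono hbound))

end Growth

section Multisets

variable {X Y : Type*} [MeasurableSpace Y] {f : X → ℝ≥0} {g : X → Y → ℝ≥0}

theorem exists_tensorPow_eq_prod_map (s : Multiset X) :
    ∃ x : Fin s.card → X, ∀ f : X → ℝ≥0, tensorPow f s.card x = (s.map f).prod := by
  induction s using Quotient.inductionOn with
  | h l => exact ⟨l.get, fun f => Fin.prod_univ_fun_getElem l f⟩

theorem MultiCopyArithmeticSeq.prod_map_le [Nonempty Y] (h : MultiCopyArithmeticSeq f g)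
    {s : Multiset X} {b : ℝ≥0} (hb : ∀ y, (s.map fun x => g x y).prod ≤ b) :
    (s.map f).prod ≤ b := by
  obtain ⟨μ, hμ, hle⟩ := h
  rcases eq_or_ne s 0 with rfl | hs
  · simpa using hb (Classical.arbitrary Y)
  refine le_of_pow_le_mul_of_expGrowthSup_nonpos hμ (Multiset.card_eq_zero.not.2 hs)
    fun k hk => ?_
  obtain ⟨x, hx⟩ := exists_tensorPow_eq_prod_map (k • s)
  have hcard : (k • s).card = k * s.card := Multiset.card_nsmul s k
  have hpow (f : X → ℝ≥0) : tensorPow f (k • s).card x = (s.map f).prod ^ k := by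
    rw [hx, Multiset.map_nsmul, Multiset.prod_nsmul]
  calc ((s.map f).prod : ℝ≥0∞) ^ k = tensorPow f (k • s).card x := by rw [hpow, ENNReal.coe_pow]
    _ ≤ ∫⁻ y, (tensorPow (fun z => g z y) (k • s).card x : ℝ≥0∞) ∂μ (k • s).card :=
      hle _ (by rw [hcard]; exact Nat.mul_pos (by omega) (Multiset.card_pos.2 hs)) x
    _ ≤ ∫⁻ _, (b : ℝ≥0∞) ^ k ∂μ (k • s).card := by
      refine lintegral_mono fun y => ?_
      rw [hpow, ENNReal.coe_pow]
      gcongr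
      exact hb y
    _ = (b : ℝ≥0∞) ^ k * μ (k * s.card) Set.univ := by rw [lintegral_const, hcard]

end Multisets

section Compact

variable {X Y : Type*} [TopologicalSpace Y]

/-- The continuous functions `h` that majorize, for some finite family `x₁, …, xₙ` with
`∏ f (xⱼ) ≠ 0`, the function `y ↦ ∑ log (g xⱼ y) - ∑ log (f xⱼ)`. Families are encoded as
multisets, and the inequality is exponentiated so that `g xⱼ y = 0` needs no convention for
`log 0`. -/
def logMajorants (f : X → ℝ≥0) (g : X → Y → ℝ≥0) : AddSubmonoid C(Y, ℝ) where
  carrier := {h | ∃ s : Multiset X, (s.map f).prod ≠ 0 ∧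
    ∀ y, ((s.map fun x => g x y).prod : ℝ) ≤ Real.exp (h y) * (s.map f).prod}
  zero_mem' := ⟨0, by simp⟩
  add_mem' := by
    rintro h k ⟨s, hs, hle⟩ ⟨t, ht, kle⟩
    refine ⟨s + t, by simpa only [Multiset.map_add, Multiset.prod_add] using mul_ne_zero hs ht,
      fun y => ?_⟩
    simp only [Multiset.map_add, Multiset.prod_add, NNReal.coe_mul, ContinuousMap.add_apply,
      Real.exp_add]
    rw [mul_mul_mul_comm]
    exact mul_le_mul (hle y) (kle y) NNReal.zero_le_coe (by positivity)

theorem MultiCopyArithmeticSeq.exists_nonneg_of_mem_logMajorants [CompactSpace Y] [Nonempty Y]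
    [MeasurableSpace Y] {f : X → ℝ≥0} {g : X → Y → ℝ≥0} (hfg : MultiCopyArithmeticSeq f g)
    {h : C(Y, ℝ)} (hh : h ∈ logMajorants f g) : ∃ y, 0 ≤ h y := by
  obtain ⟨s, hs, hle⟩ := hh
  obtain ⟨y₀, -, hy₀⟩ := isCompact_univ.exists_isMaxOn Set.univ_nonempty h.continuous.continuousOn
  refine ⟨y₀, ?_⟩
  have hprod : (s.map f).prod ≤ (Real.exp (h y₀)).toNNReal * (s.map f).prod := by
    refine hfg.prod_map_le fun y => NNReal.coe_le_coe.1 ((hle y).trans ?_)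
    rw [NNReal.coe_mul, Real.coe_toNNReal _ (Real.exp_pos _).le]
    gcongr
    exact hy₀ (Set.mem_univ y)
  simpa using (le_mul_iff_one_le_left (pos_iff_ne_zero.2 hs)).1 hprod

/-- The continuous function `max (log h) (-k)`, a finite truncation of the possibly infinite
`log h`. -/
noncomputable def truncLog (h : C(Y, ℝ≥0)) (k : ℕ) : C(Y, ℝ) where
  toFun y := Real.log (max (h y) (Real.exp (-k)))
  continuous_toFun := Continuous.log (by fun_prop)
    fun _ => (lt_max_of_lt_right (Real.exp_pos _)).ne'

theorem coe_truncLog (h : C(Y, ℝ≥0)) (k : ℕ) (y : Y) :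
    (truncLog h k y : EReal) = max (elog (h y)) (-(k : EReal)) := by
  change ((Real.log _ : ℝ) : EReal) = _
  rw [← ENNReal.log_ofReal_of_pos (lt_max_of_lt_right (Real.exp_pos _)), ENNReal.ofReal_max,
    ENNReal.log_monotone.map_max, ENNReal.ofReal_coe_nnreal,
    ENNReal.log_ofReal_of_pos (Real.exp_pos _), Real.log_exp, EReal.coe_neg,
    EReal.coe_coe_eq_natCast, elog]

theorem le_exp_truncLog (h : C(Y, ℝ≥0)) (k : ℕ) (y : Y) :
    (h y : ℝ) ≤ Real.exp (truncLog h k y) := by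
  change (h y : ℝ) ≤ Real.exp (Real.log _)
  rw [Real.exp_log (lt_max_of_lt_right (Real.exp_pos _))]
  exact le_max_left _ _

theorem truncLog_sub_log_mem_logMajorants {f : X → ℝ≥0} {g : X → C(Y, ℝ≥0)} {x : X} (hx : f x ≠ 0)
    (k : ℕ) : truncLog (g x) k - ContinuousMap.const Y (Real.log (f x)) ∈
      logMajorants f fun x => g x := by
  refine ⟨{x}, by simpa using hx, fun y => ?_⟩
  have hfx : (0 : ℝ) < f x := NNReal.coe_pos.2 (pos_iff_ne_zero.2 hx)
  simpa [Real.exp_sub, Real.exp_log hfx, hfx.ne'] using le_exp_truncLog (g x) k y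

variable [CompactSpace Y] [MeasurableSpace Y]

theorem integrable_continuousMap [OpensMeasurableSpace Y] {ν : Measure Y} [IsFiniteMeasure ν]
    (u : C(Y, ℝ)) : Integrable u ν :=
  u.continuous.integrable_of_hasCompactSupport (HasCompactSupport.of_compactSpace _)

theorem lintegral_toENNReal_elog_ne_top [OpensMeasurableSpace Y] {ν : Measure Y}
    [IsFiniteMeasure ν] (h : C(Y, ℝ≥0)) :
    ∫⁻ y, (elog (h y)).toENNReal ∂ν ≠ ⊤ := by
  have hint : Integrable (truncLog h 0) ν := integrable_continuousMap _
  refine ne_top_of_le_ne_top hint.lintegral_lt_top.ne (lintegral_mono fun y => ?_)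
  rw [← EReal.real_coe_toENNReal, coe_truncLog]
  exact EReal.toENNReal_le_toENNReal (le_max_left _ _)

theorem MultiCopyArithmeticSeq.singleCopyGeometric [Nonempty Y] [T2Space Y] [BorelSpace Y]
    {f : X → ℝ≥0} {g : X → Y → ℝ≥0} (hg : ∀ x, Continuous (g x))
    (hfg : MultiCopyArithmeticSeq f g) : SingleCopyGeometric f g := by
  lift g to X → C(Y, ℝ≥0) using hg
  obtain ⟨ν, hν, hνnonneg⟩ := exists_isProbabilityMeasure_integral_nonneg
    (P := logMajorants f fun x => g x) fun h => hfg.exists_nonneg_of_mem_logMajorants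
  have hpos (x : X) := lintegral_toENNReal_elog_ne_top (ν := ν) (g x)
  refine ⟨ν, hν, fun x => integralExists_and_extIntegral_lt_top_iff.2 (hpos x), fun x => ?_⟩
  rcases eq_or_ne (f x) 0 with hx | hx
  · simp [hx]
  have hint (k : ℕ) : Real.log (f x) ≤ ∫ y, truncLog (g x) k y ∂ν := by
    have hnonneg := hνnonneg _ (truncLog_sub_log_mem_logMajorants hx k)
    simp only [ContinuousMap.sub_apply, ContinuousMap.const_apply] at hnonneg
    rw [integral_sub (integrable_continuousMap _) (integrable_const _)] at hnonneg
    simpa using hnonneg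
  have hlog : elog (f x) ≤ extIntegral ν fun y => elog (g x y) := by
    refine ge_of_tendsto' (tendsto_extIntegral_max_neg_natCast
      (measurable_elog.comp (g x).continuous.measurable) (hpos x)) fun k => ?_
    simp only [← coe_truncLog]
    rw [extIntegral_coe (integrable_continuousMap _), elog, ENNReal.log_of_nnreal hx]
    exact EReal.coe_le_coe_iff.2 (hint k)
  simpa only [exp_elog] using EReal.exp_le_exp_iff.2 hlog

end Compact

end MeanBounds

theorem mainTheorem7 {X Y : Type*} [Nonempty X] [Nonempty Y] [MeasurableSpace Y]
    (f : X → ℝ≥0) (g : X → Y → ℝ≥0) (hg : ∀ x : X, Measurable (g x)) :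
    (MeanBounds.SingleCopyGeometric f g ↔ MeanBounds.MultiCopyGeometric f g) ∧
    (MeanBounds.MultiCopyGeometric f g → MeanBounds.MultiCopyArithmetic f g) ∧
    (MeanBounds.MultiCopyArithmetic f g → MeanBounds.MultiCopyArithmeticSeq f g) ∧
    (∀ [TopologicalSpace Y] [CompactSpace Y] [T2Space Y] [BorelSpace Y],
      (∀ x : X, Continuous (g x)) →
        MeanBounds.MultiCopyArithmeticSeq f g → MeanBounds.SingleCopyGeometric f g) :=
  ⟨⟨fun h => h.multiCopyGeometric hg, fun h => h.singleCopyGeometric⟩,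
    fun h => h.singleCopyGeometric.multiCopyArithmetic hg,
    fun h => h.multiCopyArithmeticSeq,
    fun hcont h => h.singleCopyGeometric hcont⟩
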